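/- All graphs are finite and simple. A star coloring of a graph $G$ is a proper vertex coloring $c$ such that for any two colors $i,j$ the subgraph of $G$ induced by the vertices of color $i$ or $j$ is a forest without a path $P_4$ on four vertices (i.e. a forest of stars); $|c|$ is the number of colors used. A star recoloring step takes a star coloring $c$ and a color $i$ of $c$ and recolors every vertex $v$ of color $i$ with some other color of $c$ not present in the closed neighborhood of $v$ (different vertices may get different colors), leaving all other vertices unchanged, such that the result $c'$ is again a star coloring. Let $\prec_s$ be the transitive closure of the relation "$c'$ arises from $c$ by a star recoloring step". The star b-chromatic number $S_b(G)$ is the maximum of $|c|$ over all minimal elements $c$ of $\prec_s$. A color $j\neq c(v)$ of a star coloring $c$ is blocked for a vertex $v$ if recoloring only $v$ with $j$ does not give a star coloring. The star degree $d_G^s(v)$ is the maximum, over all star colorings $c$ of $G$, of the number of colors of $c$ blocked for $v$. If $v_1,\dots,v_{|V(G)|}$ are the vertices of $G$ with $d_G^s(v_1)\ge d_G^s(v_2)\ge\cdots$, then $m_s(G)=\max\{i : i-1\le d_G^s(v_i)\}$. For $n\ge 1$ let $T_n$ be the graph that consists of the path $u,x_1^1,y^1,x_1^2,y^2,\dots,x_1^n,y^n,x_1^{n+1},v$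 and in which, for every $i\in\{1,\dots,n\}$, the vertex $y^i$ is additionally adjacent to a vertex $x_2^i$, which has one further neighbor $z^i$ of degree one, and to $3n$ vertices $w_1^i,\dots,w_{3n}^i$ of degree one. Theorem. Every $T_n$, $n\ge 1$, is a tree; $m_s(T_n)=3n+1$ for all $n\ge 2$; $S_b(T_n)=2n+2$ for all $n\ge 3$; and hence $m_s(T_n)-S_b(T_n)\to\infty$ as $n\to\infty$. In particular there is an infinite family of trees on which $m_s-S_b$ is unbounded. -/

import Mathlib

/-! ## Star colorings and the star b-chromatic number -/

section StarColorings

universe u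

variable {V : Type u}

/-- A star coloring: a proper coloring such that, for any two colors `i` and `j`, the subgraph
induced by the vertices of these two colors is a forest without a path `P₄`. Colors are natural
numbers; the colors of `c` are those in `Set.range c`. -/
def IsStarColoring (G : SimpleGraph V) (c : V → ℕ) : Prop :=
  (∀ x y, G.Adj x y → c x ≠ c y) ∧
    ∀ i j : ℕ,
      (G.induce {x | c x = i ∨ c x = j}).IsAcyclic ∧
        (SimpleGraph.pathGraph 4).Free (G.induce {x | c x = i ∨ c x = j})

/-- The set of all star colorings of `G`. -/
def StarColoring (G : SimpleGraph V) : Type u :=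
  {c : V → ℕ // IsStarColoring G c}

/-- The number `|c|` of colors of a star coloring. -/
noncomputable def StarColoring.numColors {G : SimpleGraph V} (c : StarColoring G) : ℕ :=
  (Set.range c.1).ncard

/-- `StarRecoloringStep c' c`: the star coloring `c'` arises from the star coloring `c` by
eliminating one color `i` of `c`. Each vertex `v` of color `i` receives some other color of `c`
that is not present in the closed neighborhood of `v`, and all other vertices keep their color. -/
def StarRecoloringStep {G : SimpleGraph V} (c' c : StarColoring G) : Prop :=
  ∃ i ∈ Set.range c.1,
    (∀ v, c.1 v ≠ i → c'.1 v = c.1 v) ∧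
    (∀ v, c.1 v = i → c'.1 v ∈ Set.range c.1 ∧ c'.1 v ≠ i ∧ ∀ w, G.Adj v w → c'.1 v ≠ c.1 w)

/-- The strict partial order on star colorings: the transitive closure of the relation
"arises by a star recoloring step". -/
def StarColoring.Prec {G : SimpleGraph V} (c' c : StarColoring G) : Prop :=
  Relation.TransGen StarRecoloringStep c' c

/-- Minimal elements of the strict partial order `StarColoring.Prec`. -/
def StarColoring.IsMinimalElement {G : SimpleGraph V} (c : StarColoring G) : Prop :=
  ∀ c' : StarColoring G, ¬ c'.Prec c

/-- The star b-chromatic number `S_b(G)`: the maximum number of colors of a minimal element.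
For finite `V` the set below is bounded by the number of vertices. -/
noncomputable def starBChromaticNumber [Finite V] (G : SimpleGraph V) : ℕ :=
  sSup {k | ∃ c : StarColoring G, c.IsMinimalElement ∧ c.numColors = k}

/-! ## Star degree and `m_s`-degree -/

/-- The color `j` is blocked for `v` with respect to `c`: recoloring the single vertex `v` by `j`
does not give a star coloring. (The present color `c v` is not counted as blocked here.) -/
def IsBlockedColor (G : SimpleGraph V) (c : V → ℕ) (v : V) (j : ℕ) : Prop :=
  ∀ c' : V → ℕ, c' v = j → (∀ u, u ≠ v → c' u = c u) → ¬ IsStarColoring G c'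

/-- The star degree of `v`: the maximum number of colors, other than its own, that are blocked
for `v` in a star coloring of `G`. -/
noncomputable def starDegree [Finite V] (G : SimpleGraph V) (v : V) : ℕ :=
  sSup {k | ∃ c : V → ℕ, IsStarColoring G c ∧
    {j | j ∈ Set.range c ∧ j ≠ c v ∧ IsBlockedColor G c v j}.ncard = k}

/-- The `m_s`-degree `max {i : i - 1 ≤ d^s(v_i)}`, where `v_1, v_2, …` are all the vertices,
ordered by non-increasing star degree. The enumeration `e` starts at `0`, so that `v_i` is
`e (i - 1)`; the value does not depend on the choice of `e`. -/
noncomputable def mStarDegree [Finite V] (G : SimpleGraph V) : ℕ :=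
  sSup {m | ∃ e : Fin (Nat.card V) ≃ V, Antitone (fun k => starDegree G (e k)) ∧
    ∃ k : Fin (Nat.card V), m = (k : ℕ) + 1 ∧ (k : ℕ) ≤ starDegree G (e k)}

end StarColorings

/-! ## The family of trees -/

/-- The vertices `u`, `v`, `x₁^i` (`1 ≤ i ≤ n + 1`), `x₂^i`, `y^i`, `z^i` (`1 ≤ i ≤ n`) and
`w_j^i` (`1 ≤ i ≤ n`, `1 ≤ j ≤ 3n`), with indices shifted to start at `0`. -/
inductive TreeVertex (n : ℕ) : Type
  | u : TreeVertex n
  | v : TreeVertex n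
  | x₁ (i : Fin (n + 1)) : TreeVertex n
  | x₂ (i : Fin n) : TreeVertex n
  | y (i : Fin n) : TreeVertex n
  | z (i : Fin n) : TreeVertex n
  | w (i : Fin n) (j : Fin (3 * n)) : TreeVertex n

namespace TreeVertex

/-- The edges, each listed in one direction. -/
inductive Edge (n : ℕ) : TreeVertex n → TreeVertex n → Prop
  | u_x₁ : Edge n u (x₁ 0)
  | x₁_v : Edge n (x₁ (Fin.last n)) v
  | x₁_y (i : Fin n) : Edge n (x₁ i.castSucc) (y i)
  | y_x₁ (i : Fin n) : Edge n (y i) (x₁ i.succ)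
  | y_x₂ (i : Fin n) : Edge n (y i) (x₂ i)
  | x₂_z (i : Fin n) : Edge n (x₂ i) (z i)
  | y_w (i : Fin n) (j : Fin (3 * n)) : Edge n (y i) (w i j)

instance (n : ℕ) : Finite (TreeVertex n) :=
  Finite.of_surjective
    (fun s : (Unit ⊕ Unit ⊕ Fin (n + 1)) ⊕ (Fin n ⊕ Fin n ⊕ Fin n ⊕ Fin n × Fin (3 * n)) =>
      match s with
      | .inl (.inl _) => (u : TreeVertex n)
      | .inl (.inr (.inl _)) => v
      | .inl (.inr (.inr i)) => x₁ i
      | .inr (.inl i) => x₂ i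
      | .inr (.inr (.inl i)) => y i
      | .inr (.inr (.inr (.inl i))) => z i
      | .inr (.inr (.inr (.inr (i, j)))) => w i j)
    (fun a => match a with
      | .u => ⟨.inl (.inl ()), rfl⟩
      | .v => ⟨.inl (.inr (.inl ())), rfl⟩
      | .x₁ i => ⟨.inl (.inr (.inr i)), rfl⟩
      | .x₂ i => ⟨.inr (.inl i), rfl⟩
      | .y i => ⟨.inr (.inr (.inl i)), rfl⟩
      | .z i => ⟨.inr (.inr (.inr (.inl i))), rfl⟩
      | .w i j => ⟨.inr (.inr (.inr (.inr (i, j)))), rfl⟩)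

end TreeVertex

/-- The tree `T_n`: the path `u, x₁^1, y^1, x₁^2, …, y^n, x₁^{n+1}, v`, where in addition each
`y^i` carries the pendant path `y^i, x₂^i, z^i` and `3n` leaves `w_j^i`. -/
def treeT (n : ℕ) : SimpleGraph (TreeVertex n) :=
  SimpleGraph.fromRel (TreeVertex.Edge n)

/-! In a forest, a proper coloring is a star coloring as soon as no path on four vertices is colored
alternately (`IsStarColoring.of_acyclic`).

For `m_s`: each of the `3n + 1` inner vertices can have the colors of `3n` leaves blocked. For `y i`
they are colors of neighbors; for a neighbor `t` of `y i` with a second neighbor `a`, give `a` the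
color of `y i`, so that `a, t, y i, w i j` blocks the color of each `w i j`. A leaf has at most 4
blocked colors.

Upper bound for `S_b`: if the neighbors of a leaf or of an `x₁ k` have distinct colors, at most six
vertices block it. With eight colors, a color therefore survives only if it occurs on some `y`, on
some `x₂`, or on an `x₁ k` with equally colored neighbors (`not_isMinimalElement_treeT`). Such an
`x₁ k` between two `y`'s costs a repetition among the colors of the `y`'s, so the `y`'s and the
interior `x₁`'s account for only `n` colors; the `x₂`'s and the two end `x₁`'s add `n + 2`.

Lower bound: `extremalColor` gives both neighbors of each `x₁` and `x₂` color `0` and lets every `y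
i` see all other colors, so no color can be eliminated. The difference is `n - 1`. -/

section ColoringLemmas

variable {V : Type*} {G : SimpleGraph V}

/-- A graph with a rank function such that no vertex has two neighbors of at most its own rank is
acyclic. -/
theorem SimpleGraph.isAcyclic_of_rank (r : V → ℕ)
    (h : ∀ v a b, G.Adj v a → G.Adj v b → r a ≤ r v → r b ≤ r v → a = b) : G.IsAcyclic := by
  classical
  intro v p hp
  -- A vertex of maximal rank on the cycle has two distinct cycle neighbors, both of at most its
  -- rank.
  obtain ⟨m, hm, hmax⟩ := p.support.toFinset.exists_max_image r ⟨v, by simp⟩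
  rw [List.mem_toFinset] at hm
  have hq := hp.rotate hm
  have hsub : ∀ x ∈ (p.rotate m hm).support, r x ≤ r m := by
    intro x hx
    apply hmax
    rw [List.mem_toFinset]
    exact (SimpleGraph.Walk.mem_support_rotate_iff _ _ hm).1 hx
  refine hq.snd_ne_penultimate (h m _ _ ?_ ?_ ?_ ?_)
  · exact SimpleGraph.Walk.adj_snd hq.not_nil
  · exact (SimpleGraph.Walk.adj_penultimate hq.not_nil).symm
  · exact hsub _ (SimpleGraph.Walk.getVert_mem_support _ _)
  · exact hsub _ (SimpleGraph.Walk.getVert_mem_support _ _)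

theorem IsStarColoring.ne_of_path {c : V → ℕ} (hc : IsStarColoring G c) {a b d e : V}
    (hab : G.Adj a b) (hbd : G.Adj b d) (hde : G.Adj d e) (had : a ≠ d) (hbe : b ≠ e)
    (h₁ : c a = c d) : c b ≠ c e := by
  intro h₂
  have hae : a ≠ e := by
    rintro rfl
    exact hc.1 _ _ hde h₁.symm
  refine (hc.2 (c a) (c b)).2 ⟨⟨⟨?_, ?_⟩, ?_⟩⟩
  · exact ![⟨a, .inl rfl⟩, ⟨b, .inr rfl⟩, ⟨d, .inl h₁.symm⟩, ⟨e, .inr h₂.symm⟩]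
  · intro i j hij
    rw [SimpleGraph.pathGraph_adj] at hij
    fin_cases i <;> fin_cases j <;> simp_all [SimpleGraph.adj_comm]
  · intro i j hij
    have := hab.ne
    have := hbd.ne
    have := hde.ne
    fin_cases i <;> fin_cases j <;> simp_all [eq_comm]

/-- Induced subgraphs of a forest are forests, and a proper coloring of a path with two colors must
alternate. -/
theorem IsStarColoring.of_acyclic (hG : G.IsAcyclic) {c : V → ℕ}
    (h₁ : ∀ x y, G.Adj x y → c x ≠ c y)
    (h₂ : ∀ a b d e, G.Adj a b → G.Adj b d → G.Adj d e → a ≠ d → b ≠ e → c a = c d → c b ≠ c e) :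
    IsStarColoring G c := by
  refine ⟨h₁, fun i j => ⟨hG.induce _, ?_⟩⟩
  rintro ⟨⟨f, hf⟩⟩
  have hadj : ∀ k l : Fin 4, (k : ℕ) + 1 = l → G.Adj (f k).1 (f l).1 := fun k l hkl =>
    f.map_rel (SimpleGraph.pathGraph_adj.2 (.inl hkl))
  have hne : ∀ k l : Fin 4, k ≠ l → (f k).1 ≠ (f l).1 := fun k l hkl h =>
    hkl (hf (Subtype.ext h))
  have a01 := hadj 0 1 rfl
  have a12 := hadj 1 2 rfl
  have a23 := hadj 2 3 rfl
  have c01 := h₁ _ _ a01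
  have c12 := h₁ _ _ a12
  have c23 := h₁ _ _ a23
  have m0 : c (f 0).1 = i ∨ c (f 0).1 = j := (f 0).2
  have m1 : c (f 1).1 = i ∨ c (f 1).1 = j := (f 1).2
  have m2 : c (f 2).1 = i ∨ c (f 2).1 = j := (f 2).2
  have m3 : c (f 3).1 = i ∨ c (f 3).1 = j := (f 3).2
  exact h₂ _ _ _ _ a01 a12 a23 (hne 0 2 (by decide)) (hne 1 3 (by decide)) (by omega) (by omega)

/-- If the neighbors of `v` have distinct colors, then only colors of neighbors of `v` and of
inner vertices at distance two can be blocked for `v`. -/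
theorem IsStarColoring.update [DecidableEq V] (hG : G.IsAcyclic) {c : V → ℕ}
    (hc : IsStarColoring G c) {v : V} {j : ℕ} {B : Set V} (hB₁ : ∀ a, G.Adj v a → a ∈ B)
    (hB₂ : ∀ a b e, G.Adj v a → G.Adj a b → G.Adj b e → b ≠ v → e ≠ a → b ∈ B)
    (hv : ∀ a b, G.Adj v a → G.Adj v b → a ≠ b → c a ≠ c b) (hj : j ∉ c '' B) :
    IsStarColoring G (Function.update c v j) := by
  have hj' : ∀ b ∈ B, c b ≠ j := fun b hb h => hj ⟨b, hb, h⟩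
  have hprop : ∀ x y, G.Adj x y → Function.update c v j x ≠ Function.update c v j y := by
    intro x y hxy
    have hne := hxy.ne
    by_cases hx : x = v
    · subst hx
      rw [Function.update_self, Function.update_of_ne hne.symm]
      exact (hj' _ (hB₁ _ hxy)).symm
    · by_cases hy : y = v
      · subst hy
        rw [Function.update_self, Function.update_of_ne hx]
        exact hj' _ (hB₁ _ hxy.symm)
      · rw [Function.update_of_ne hx, Function.update_of_ne hy]
        exact hc.1 _ _ hxy
  refine .of_acyclic hG hprop ?_
  intro a b d e hab hbd hde had hbe h₁ h₂
  -- Consider the position of `v` on an alternating path. At an end, `j` would be the color of an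
  -- inner vertex at distance two; in the middle, two neighbors of `v` would share a color.
  by_cases ha : a = v
  · subst ha
    rw [Function.update_self, Function.update_of_ne had.symm] at h₁
    exact hj' _ (hB₂ _ _ _ hab hbd hde had.symm hbe.symm) h₁.symm
  by_cases he : e = v
  · subst he
    rw [Function.update_self, Function.update_of_ne hbe] at h₂
    exact hj' _ (hB₂ _ _ _ hde.symm hbd.symm hab.symm hbe had) h₂
  by_cases hb : b = v
  · subst hb
    rw [Function.update_of_ne hab.ne, Function.update_of_ne hbd.ne.symm] at h₁
    exact hv _ _ hab.symm hbd had h₁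
  by_cases hd : d = v
  · subst hd
    rw [Function.update_of_ne hbd.ne, Function.update_of_ne hde.ne.symm] at h₂
    exact hv _ _ hbd.symm hde hbe h₂
  rw [Function.update_of_ne ha, Function.update_of_ne hd] at h₁
  rw [Function.update_of_ne hb, Function.update_of_ne he] at h₂
  exact hc.ne_of_path hab hbd hde had hbe h₁ h₂

/-! ### Minimal elements and elimination of a color -/

theorem StarColoring.isMinimalElement_iff {c : StarColoring G} :
    c.IsMinimalElement ↔ ∀ c' : StarColoring G, ¬ StarRecoloringStep c' c := by
  constructor
  · exact fun h c' hc' => h c' (.single hc')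
  · intro h c' hc'
    cases hc' with
    | single hs => exact h _ hs
    | tail _ hs => exact h _ hs

/-- A color can be eliminated if its vertices can be recolored one after the other. -/
theorem StarColoring.not_isMinimalElement_of_greedy [Finite V] [DecidableEq V]
    (c : StarColoring G) {i : ℕ} (hi : i ∈ Set.range c.1)
    (h : ∀ v, c.1 v = i → ∀ d : V → ℕ, IsStarColoring G d → (∀ w, c.1 w ≠ i → d w = c.1 w) →
      ∃ j ∈ Set.range c.1, j ≠ i ∧ IsStarColoring G (Function.update d v j)) :
    ¬ c.IsMinimalElement := by
  -- Induction on the number of vertices that still have color `i`.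
  have key : ∀ m : ℕ, ∀ d : V → ℕ, IsStarColoring G d → (∀ w, c.1 w ≠ i → d w = c.1 w) →
      (∀ w, d w ∈ Set.range c.1) → {w | d w = i}.ncard = m →
      ∃ d' : V → ℕ, IsStarColoring G d' ∧ (∀ w, c.1 w ≠ i → d' w = c.1 w) ∧
        (∀ w, d' w ∈ Set.range c.1) ∧ ∀ w, d' w ≠ i := by
    intro m
    induction m with
    | zero =>
      intro d hd h₁ h₂ h₃
      rw [Set.ncard_eq_zero] at h₃
      exact ⟨d, hd, h₁, h₂, fun w hw => (h₃ ▸ hw : w ∈ (∅ : Set V))⟩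
    | succ m ih =>
      intro d hd h₁ h₂ h₃
      obtain ⟨v, hv⟩ : {w | d w = i}.Nonempty := by
        rw [← Set.ncard_pos]; omega
      have hvi : c.1 v = i := by
        by_contra hne
        exact hne ((h₁ v hne).symm.trans hv)
      obtain ⟨j, hj, hji, hs⟩ := h v hvi d hd h₁
      refine ih _ hs ?_ ?_ ?_
      · intro w hw
        rw [Function.update_of_ne (by rintro rfl; exact hw hvi)]
        exact h₁ w hw
      · intro w
        by_cases hwv : w = v
        · subst hwv; rwa [Function.update_self]
        · rw [Function.update_of_ne hwv]; exact h₂ w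
      · have : {w | Function.update d v j w = i} = {w | d w = i} \ {v} := by
          ext w
          by_cases hwv : w = v
          · subst hwv; simp [hji]
          · simp [hwv]
        rw [this, Set.ncard_sdiff_singleton_of_mem hv, h₃]
        rfl
  obtain ⟨d, hd, h₁, h₂, h₃⟩ := key _ c.1 c.2 (fun _ _ => rfl) (fun w => ⟨w, rfl⟩) rfl
  rw [isMinimalElement_iff]
  push Not
  refine ⟨⟨d, hd⟩, i, hi, h₁, fun v hv => ⟨h₂ v, h₃ v, fun w hw hvw => ?_⟩⟩
  -- A color class is independent, so the neighbors of `v` keep their colors and properness of `d`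
  -- yields the condition on the old colors.
  have hwi : c.1 w ≠ i := fun hwi => c.2.1 _ _ hw (hv.trans hwi.symm)
  exact hd.1 _ _ hw (hvw.trans (h₁ w hwi).symm)

/-! ### Star degree and `m_s`-degree -/

variable [Finite V]

theorem ncard_blocked_le_starDegree {c : V → ℕ} (hc : IsStarColoring G c) (v : V) :
    {j | j ∈ Set.range c ∧ j ≠ c v ∧ IsBlockedColor G c v j}.ncard ≤ starDegree G v := by
  refine le_csSup ⟨Nat.card V, ?_⟩ ⟨c, hc, rfl⟩
  rintro _ ⟨d, -, rfl⟩
  refine (Set.ncard_le_ncard (fun j hj => hj.1) (Set.finite_range d)).trans ?_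
  rw [← Set.image_univ, ← Set.ncard_univ]
  exact Set.ncard_image_le

theorem starDegree_le {v : V} {m : ℕ}
    (h : ∀ c, IsStarColoring G c → {j | IsBlockedColor G c v j}.Finite ∧
      {j | IsBlockedColor G c v j}.ncard ≤ m) : starDegree G v ≤ m := by
  refine csSup_le' ?_
  rintro _ ⟨c, hc, rfl⟩
  exact (Set.ncard_le_ncard (fun j hj => hj.2.2) (h c hc).1).trans (h c hc).2

theorem mStarDegree_eq {H : Set V} {M : ℕ} (hcard : H.ncard = M + 1)
    (h₁ : ∀ v ∈ H, M ≤ starDegree G v) (h₂ : ∀ v, v ∉ H → starDegree G v ≤ M) :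
    mStarDegree G = M + 1 := by
  have hle : M + 1 ≤ Nat.card V := by
    rw [← hcard, ← Set.ncard_univ]
    exact Set.ncard_le_ncard (Set.subset_univ _)
  refine IsGreatest.csSup_eq ⟨?_, ?_⟩
  · let e₀ := (Finite.equivFin V).symm
    let f : Fin (Nat.card V) → ℕᵒᵈ := fun k => OrderDual.toDual (starDegree G (e₀ k))
    let e := (Tuple.sort f).trans e₀
    have he : Antitone (fun k => starDegree G (e k)) := fun k l hkl => Tuple.monotone_sort f hkl
    refine ⟨e, he, ⟨M, hle⟩, rfl, ?_⟩
    by_contra hlt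
    -- Otherwise all `M + 1` vertices of `H` would occupy the `M` positions before index `M`.
    have hsub : H ⊆ e '' Set.Iio ⟨M, hle⟩ := by
      intro v hv
      refine ⟨e.symm v, ?_, e.apply_symm_apply v⟩
      by_contra hge
      have := he (not_lt.1 hge)
      simp only [Equiv.apply_symm_apply] at this
      exact hlt ((h₁ v hv).trans this)
    have := Set.ncard_le_ncard hsub
    rw [Set.ncard_image_of_injective _ e.injective, hcard, ← Nat.card_coe_set_eq] at this
    simp at this
  · rintro _ ⟨e, he, k, rfl, hk⟩
    by_contra hlt
    -- Here `k > M`, so the first `k + 1` vertices all have star degree above `M`, too many for `H`.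
    have hsub : e '' Set.Iic k ⊆ H := by
      rintro _ ⟨l, hl, rfl⟩
      by_contra hH
      have := h₂ _ hH
      have := he hl
      simp only at this
      omega
    have := Set.ncard_le_ncard hsub
    rw [Set.ncard_image_of_injective _ e.injective, hcard, ← Nat.card_coe_set_eq] at this
    simp at this
    omega

end ColoringLemmas

/-! ### Adjacency and tree structure of `treeT n` -/

section Tree

open TreeVertex

variable {n : ℕ}

/-- The neighbor of `x₁ i` towards `u`. -/
def TreeVertex.left (i : Fin (n + 1)) : TreeVertex n :=
  Fin.cases u y i

/-- The neighbor of `x₁ i` towards `v`. -/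
def TreeVertex.right (i : Fin (n + 1)) : TreeVertex n :=
  Fin.lastCases v y i

@[simp] theorem TreeVertex.left_zero : left (0 : Fin (n + 1)) = u := rfl

@[simp] theorem TreeVertex.left_succ (i : Fin n) : left i.succ = y i := rfl

@[simp] theorem TreeVertex.right_last : right (Fin.last n) = v := by simp [right]

@[simp] theorem TreeVertex.right_castSucc (i : Fin n) : right i.castSucc = y i := by simp [right]

theorem treeT_adj {a b : TreeVertex n} : (treeT n).Adj a b ↔ Edge n a b ∨ Edge n b a := by
  rw [treeT, SimpleGraph.fromRel_adj, and_iff_right_of_imp]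
  rintro (h | h) <;> cases h <;> simp

theorem treeT_adj_u {a : TreeVertex n} : (treeT n).Adj u a ↔ a = x₁ 0 := by
  rw [treeT_adj]
  constructor
  · rintro (h | h) <;> cases h; rfl
  · rintro rfl; exact .inl .u_x₁

theorem treeT_adj_v {a : TreeVertex n} : (treeT n).Adj v a ↔ a = x₁ (Fin.last n) := by
  rw [treeT_adj]
  constructor
  · rintro (h | h) <;> cases h; rfl
  · rintro rfl; exact .inr .x₁_v

theorem treeT_adj_z {i : Fin n} {a : TreeVertex n} : (treeT n).Adj (z i) a ↔ a = x₂ i := by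
  rw [treeT_adj]
  constructor
  · rintro (h | h) <;> cases h; rfl
  · rintro rfl; exact .inr (.x₂_z i)

theorem treeT_adj_w {i : Fin n} {j : Fin (3 * n)} {a : TreeVertex n} :
    (treeT n).Adj (w i j) a ↔ a = y i := by
  rw [treeT_adj]
  constructor
  · rintro (h | h) <;> cases h; rfl
  · rintro rfl; exact .inr (.y_w i j)

theorem treeT_adj_x₂ {i : Fin n} {a : TreeVertex n} :
    (treeT n).Adj (x₂ i) a ↔ a = y i ∨ a = z i := by
  rw [treeT_adj]
  constructor
  · rintro (h | h) <;> cases h <;> simp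
  · rintro (rfl | rfl)
    · exact .inr (.y_x₂ i)
    · exact .inl (.x₂_z i)

theorem treeT_adj_x₁ {i : Fin (n + 1)} {a : TreeVertex n} :
    (treeT n).Adj (x₁ i) a ↔ a = left i ∨ a = right i := by
  rw [treeT_adj]
  constructor
  · rintro (h | h) <;> cases h <;> simp
  · rintro (rfl | rfl)
    · cases i using Fin.cases with
      | zero => exact .inr .u_x₁
      | succ i => exact .inr (.y_x₁ i)
    · cases i using Fin.lastCases with
      | last => rw [right_last]; exact .inl .x₁_v
      | cast i => rw [right_castSucc]; exact .inl (.x₁_y i)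

theorem treeT_adj_y {i : Fin n} {a : TreeVertex n} :
    (treeT n).Adj (y i) a ↔
      a = x₁ i.castSucc ∨ a = x₁ i.succ ∨ a = x₂ i ∨ ∃ j, a = w i j := by
  rw [treeT_adj]
  constructor
  · rintro (h | h) <;> cases h <;> simp
  · rintro (rfl | rfl | rfl | ⟨j, rfl⟩)
    · exact .inr (.x₁_y i)
    · exact .inl (.y_x₁ i)
    · exact .inl (.y_x₂ i)
    · exact .inl (.y_w i j)

theorem TreeVertex.left_ne_right (i : Fin (n + 1)) : left i ≠ right i := by
  cases i using Fin.cases with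
  | zero =>
    cases n with
    | zero =>
      have : right (0 : Fin 1) = v := right_last
      simp [this]
    | succ n =>
      have : right (0 : Fin (n + 2)) = y 0 := right_castSucc (0 : Fin (n + 1))
      simp [this]
  | succ i =>
    rw [left_succ]
    intro h
    have := (treeT_adj (a := right i.succ) (b := x₁ i.succ)).1 (treeT_adj_x₁.2 (.inr rfl)).symm
    generalize hk : i.succ = k at h this
    cases k using Fin.lastCases with
    | last => simp at h
    | cast k =>
      rw [right_castSucc] at h
      obtain rfl : i = k := by simpa using h
      exact absurd hk (by simp [Fin.ext_iff])

theorem treeT_isAcyclic (n : ℕ) : (treeT n).IsAcyclic := by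
  -- `r` is the distance from the root `u` and `p` the parent; the value `p u` is a dummy, since no
  -- neighbor of `u` has rank `0`.
  let r : TreeVertex n → ℕ
    | u => 0
    | v => 2 * n + 2
    | x₁ i => 2 * i + 1
    | x₂ i => 2 * i + 3
    | y i => 2 * i + 2
    | z i => 2 * i + 4
    | w i _ => 2 * i + 3
  let p : TreeVertex n → TreeVertex n
    | u => u
    | v => x₁ (Fin.last n)
    | x₁ i => left i
    | x₂ i => y i
    | y i => x₁ i.castSucc
    | z i => x₂ i
    | w i _ => y i
  have key : ∀ t a, (treeT n).Adj t a → r a ≤ r t → a = p t := by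
    intro t a ha hr
    rw [treeT_adj] at ha
    rcases ha with ha | ha <;> cases ha <;> simp [r, p] at hr ⊢
    omega
  exact SimpleGraph.isAcyclic_of_rank r fun t a b ha hb hra hrb =>
    (key t a ha hra).trans (key t b hb hrb).symm

theorem treeT_isTree (n : ℕ) : (treeT n).IsTree := by
  refine ⟨?_, treeT_isAcyclic n⟩
  have hx : ∀ i : Fin (n + 1), (treeT n).Reachable u (x₁ i) := by
    intro i
    induction i using Fin.induction with
    | zero => exact (treeT_adj_u.2 rfl).reachable
    | succ i ih =>
      refine ih.trans (SimpleGraph.Reachable.trans (v := y i) ?_ ?_)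
      · exact (treeT_adj_y.2 (.inl rfl)).symm.reachable
      · exact (treeT_adj_y.2 (.inr (.inl rfl))).reachable
  have hy : ∀ i : Fin n, (treeT n).Reachable u (y i) := fun i =>
    (hx i.succ).trans (treeT_adj_y.2 (.inr (.inl rfl))).symm.reachable
  have hx₂ : ∀ i : Fin n, (treeT n).Reachable u (x₂ i) := fun i =>
    (hy i).trans (treeT_adj_x₂.2 (.inl rfl)).symm.reachable
  rw [SimpleGraph.connected_iff_exists_forall_reachable]
  refine ⟨u, fun t => ?_⟩
  cases t with
  | u => exact .rfl
  | v => exact (hx _).trans (treeT_adj_v.2 rfl).symm.reachable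
  | x₁ i => exact hx i
  | x₂ i => exact hx₂ i
  | y i => exact hy i
  | z i => exact (hx₂ i).trans (treeT_adj_z.2 rfl).symm.reachable
  | w i j => exact (hy i).trans (treeT_adj_w.2 rfl).symm.reachable

/-! ### Vertices that can block a color -/

/-- The `3n` leaves at `y i` never continue a path. This keeps the number of blockers at distance
two independent of `n`. -/
theorem TreeVertex.eq_of_adj_y_of_adj {i : Fin n} {b e : TreeVertex n} (hb : (treeT n).Adj (y i) b)
    (he : (treeT n).Adj b e) (hne : e ≠ y i) : b = x₁ i.castSucc ∨ b = x₁ i.succ ∨ b = x₂ i := by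
  rw [treeT_adj_y] at hb
  rcases hb with rfl | rfl | rfl | ⟨j, rfl⟩
  · simp
  · simp
  · simp
  · exact absurd (treeT_adj_w.1 he) hne

/-- The vertices whose colors can be blocked for `t` when the neighbors of `t` have distinct
colors. -/
def TreeVertex.IsBlockerList (t : TreeVertex n) (l : List (TreeVertex n)) : Prop :=
  (∀ a, (treeT n).Adj t a → a ∈ l) ∧
    ∀ a b e, (treeT n).Adj t a → (treeT n).Adj a b → (treeT n).Adj b e → b ≠ t → e ≠ a → b ∈ l

theorem TreeVertex.IsBlockerList.isStarColoring_update [DecidableEq (TreeVertex n)]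
    {t : TreeVertex n} {l : List (TreeVertex n)} (hl : t.IsBlockerList l) {c : TreeVertex n → ℕ}
    (hc : IsStarColoring (treeT n) c)
    (ht : ∀ a b, (treeT n).Adj t a → (treeT n).Adj t b → a ≠ b → c a ≠ c b) {j : ℕ}
    (hj : j ∉ l.map c) : IsStarColoring (treeT n) (Function.update c t j) :=
  hc.update (treeT_isAcyclic n) (B := {a | a ∈ l}) hl.1 hl.2 ht fun ⟨a, ha, h⟩ =>
    hj (List.mem_map.2 ⟨a, ha, h⟩)

/-- The leaves of `treeT n`. -/
def TreeVertex.IsLeaf : TreeVertex n → Prop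
  | u => True
  | v => True
  | z _ => True
  | w _ _ => True
  | x₁ _ => False
  | x₂ _ => False
  | y _ => False

theorem TreeVertex.IsLeaf.eq_of_adj {t a b : TreeVertex n} (ht : t.IsLeaf)
    (ha : (treeT n).Adj t a) (hb : (treeT n).Adj t b) : a = b := by
  cases t with
  | u => rw [treeT_adj_u] at ha hb; exact ha.trans hb.symm
  | v => rw [treeT_adj_v] at ha hb; exact ha.trans hb.symm
  | z i => rw [treeT_adj_z] at ha hb; exact ha.trans hb.symm
  | w i j => rw [treeT_adj_w] at ha hb; exact ha.trans hb.symm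
  | x₁ i => exact ht.elim
  | x₂ i => exact ht.elim
  | y i => exact ht.elim

theorem TreeVertex.IsLeaf.exists_isBlockerList {t : TreeVertex n} (ht : t.IsLeaf) :
    ∃ l : List (TreeVertex n), l.length ≤ 4 ∧ t.IsBlockerList l := by
  cases t with
  | u =>
    refine ⟨[x₁ 0, left 0, right 0], by simp, ?_, ?_⟩
    · intro a ha
      simp [treeT_adj_u.1 ha]
    · intro a b e ha hb he hbt hea
      obtain rfl := treeT_adj_u.1 ha
      rcases treeT_adj_x₁.1 hb with rfl | rfl <;> simp
  | v =>
    refine ⟨[x₁ (Fin.last n), left (Fin.last n), right (Fin.last n)], by simp, ?_, ?_⟩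
    · intro a ha
      simp [treeT_adj_v.1 ha]
    · intro a b e ha hb he hbt hea
      obtain rfl := treeT_adj_v.1 ha
      rcases treeT_adj_x₁.1 hb with rfl | rfl <;> simp
  | z i =>
    refine ⟨[x₂ i, y i, z i], by simp, ?_, ?_⟩
    · intro a ha
      simp [treeT_adj_z.1 ha]
    · intro a b e ha hb he hbt hea
      obtain rfl := treeT_adj_z.1 ha
      rcases treeT_adj_x₂.1 hb with rfl | rfl <;> simp
  | w i j =>
    refine ⟨[y i, x₁ i.castSucc, x₁ i.succ, x₂ i], by simp, ?_, ?_⟩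
    · intro a ha
      simp [treeT_adj_w.1 ha]
    · intro a b e ha hb he hbt hea
      obtain rfl := treeT_adj_w.1 ha
      rcases eq_of_adj_y_of_adj hb he hea with rfl | rfl | rfl <;> simp
  | x₁ i => exact ht.elim
  | x₂ i => exact ht.elim
  | y i => exact ht.elim

/-- Two neighbors, each with at most two further inner neighbors, give `2 + 2 + 2`. -/
theorem TreeVertex.exists_isBlockerList_x₁ (i : Fin (n + 1)) :
    ∃ l : List (TreeVertex n), l.length ≤ 6 ∧ (x₁ i).IsBlockerList l := by
  obtain ⟨l, hl, hl'⟩ : ∃ l : List (TreeVertex n), l.length = 2 ∧ ∀ b e,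
      (treeT n).Adj (left i) b → (treeT n).Adj b e → b ≠ x₁ i → e ≠ left i → b ∈ l := by
    cases i using Fin.cases with
    | zero =>
      -- A leaf contributes no blocker at distance two; the entries only pad the list to length 2.
      refine ⟨[u, u], rfl, fun b e hb he hbt hea => ?_⟩
      exact absurd (treeT_adj_u.1 hb) hbt
    | succ i =>
      refine ⟨[x₁ i.castSucc, x₂ i], rfl, fun b e hb he hbt hea => ?_⟩
      rcases eq_of_adj_y_of_adj hb he hea with rfl | rfl | rfl <;> simp at hbt ⊢
  obtain ⟨r, hr, hr'⟩ : ∃ l : List (TreeVertex n), l.length = 2 ∧ ∀ b e,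
      (treeT n).Adj (right i) b → (treeT n).Adj b e → b ≠ x₁ i → e ≠ right i → b ∈ l := by
    cases i using Fin.lastCases with
    | last =>
      refine ⟨[u, u], rfl, fun b e hb he hbt hea => ?_⟩
      rw [right_last] at hb
      exact absurd (treeT_adj_v.1 hb) hbt
    | cast i =>
      refine ⟨[x₁ i.succ, x₂ i], rfl, fun b e hb he hbt hea => ?_⟩
      rw [right_castSucc] at hb hea
      rcases eq_of_adj_y_of_adj hb he hea with rfl | rfl | rfl <;> simp at hbt ⊢
  refine ⟨[left i, right i] ++ l ++ r, by simp [hl, hr], ?_, ?_⟩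
  · intro a ha
    rcases treeT_adj_x₁.1 ha with rfl | rfl <;> simp
  · intro a b e ha hb he hbt hea
    rcases treeT_adj_x₁.1 ha with rfl | rfl
    · simp [hl' b e hb he hbt hea]
    · simp [hr' b e hb he hbt hea]

/-! ### Star degrees in `treeT n` and the value of `m_s` -/

theorem TreeVertex.IsLeaf.starDegree_le {t : TreeVertex n} (ht : t.IsLeaf) :
    starDegree (treeT n) t ≤ 4 := by
  classical
  obtain ⟨l, hl, hB⟩ := ht.exists_isBlockerList
  refine _root_.starDegree_le fun c hc => ?_
  have hsub : {j | IsBlockedColor (treeT n) c t j} ⊆ ((l.map c).toFinset : Set ℕ) := by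
    intro j hj
    by_contra hjl
    refine hj (Function.update c t j) (Function.update_self ..)
      (fun a ha => Function.update_of_ne ha ..) (hB.isStarColoring_update hc ?_ ?_)
    · exact fun a b ha hb hab => absurd (ht.eq_of_adj ha hb) hab
    · simpa using hjl
  refine ⟨(Finset.finite_toSet _).subset hsub, ?_⟩
  refine (Set.ncard_le_ncard hsub (Finset.finite_toSet _)).trans ?_
  rw [Set.ncard_coe_finset]
  refine (List.toFinset_card_le _).trans ?_
  simpa using hl

theorem le_starDegree_of_blocked_leaves {c : TreeVertex n → ℕ} (hc : IsStarColoring (treeT n) c)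
    {t : TreeVertex n} (i : Fin n) (hinj : ∀ j k, c (w i j) = c (w i k) → j = k)
    (ht : ∀ j, c (w i j) ≠ c t)
    (hblocked : ∀ j, IsBlockedColor (treeT n) c t (c (w i j))) :
    3 * n ≤ starDegree (treeT n) t := by
  refine le_trans ?_ (ncard_blocked_le_starDegree hc t)
  have hsub : Set.range (fun j => c (w i j)) ⊆
      {j | j ∈ Set.range c ∧ j ≠ c t ∧ IsBlockedColor (treeT n) c t j} := by
    rintro _ ⟨j, rfl⟩
    exact ⟨⟨_, rfl⟩, ht j, hblocked j⟩
  refine le_trans ?_ (Set.ncard_le_ncard hsub ((Set.finite_range c).subset fun j hj => hj.1))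
  rw [← Set.image_univ, Set.ncard_image_of_injective _ (fun j k h => hinj j k h), Set.ncard_univ]
  simp

theorem le_starDegree_y (i : Fin n) : 3 * n ≤ starDegree (treeT n) (y i) := by
  obtain ⟨c, hinj⟩ := exists_injective_nat (TreeVertex n)
  have hc : IsStarColoring (treeT n) c :=
    .of_acyclic (treeT_isAcyclic n) (fun a b hab h => hab.ne (hinj h))
      fun a b d e _ _ _ had _ h => absurd (hinj h) had
  refine le_starDegree_of_blocked_leaves hc i ?_ ?_ ?_
  · intro j k h
    simpa using hinj h
  · intro j h
    simpa using hinj h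
  · intro j c' h₁ h₂ h
    exact h.1 _ _ (treeT_adj_y.2 (.inr (.inr (.inr ⟨j, rfl⟩)))) (h₁.trans (h₂ _ (by simp)).symm)

/-- All vertices get distinct colors except that `a` repeats the color of `y i`. Giving `t` the
color of `w i j` would make `a, t, y i, w i j` alternate. -/
theorem le_starDegree_of_adj_y {i : Fin n} {t a : TreeVertex n} (ht : (treeT n).Adj t (y i))
    (ha : (treeT n).Adj t a) (hay : a ≠ y i) : 3 * n ≤ starDegree (treeT n) t := by
  classical
  have htw : ∀ j, t ≠ w i j := by
    rintro j rfl
    exact hay (treeT_adj_w.1 ha)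
  have haw : ∀ j, a ≠ w i j := by
    rintro j rfl
    obtain rfl := treeT_adj_w.1 ha.symm
    exact ht.ne rfl
  obtain ⟨f, hinj⟩ := exists_injective_nat (TreeVertex n)
  let c := Function.update f a (f (y i))
  have hca : c a = f (y i) := Function.update_self ..
  have hcb : ∀ b, b ≠ a → c b = f b := fun b hb => Function.update_of_ne hb ..
  have hc_eq : ∀ b d, c b = c d → b = d ∨ (b = a ∧ d = y i) ∨ (d = a ∧ b = y i) := by
    intro b d h
    by_cases hb : b = a <;> by_cases hd : d = a
    · exact .inl (hb.trans hd.symm)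
    · rw [hb, hca, hcb _ hd] at h
      exact .inr (.inl ⟨hb, (hinj h).symm⟩)
    · rw [hd, hca, hcb _ hb] at h
      exact .inr (.inr ⟨hd, hinj h⟩)
    · rw [hcb _ hd, hcb _ hb] at h
      exact .inl (hinj h)
  -- An edge would close a triangle with `t`; properness of `c` needs its absence.
  have hnadj : ¬ (treeT n).Adj a (y i) := by
    intro h
    have := (SimpleGraph.isAcyclic_iff_subsingleton_path.1 (treeT_isAcyclic n) a (y i)).elim
      ⟨.cons h .nil, by simp [hay]⟩
      ⟨.cons ha.symm (.cons ht .nil), by simp [hay, ha.ne.symm, ht.ne]⟩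
    have := congrArg (fun p => p.1.length) this
    simp at this
  have hc : IsStarColoring (treeT n) c := by
    refine .of_acyclic (treeT_isAcyclic n) ?_ ?_
    · intro b d hbd h
      rcases hc_eq _ _ h with rfl | ⟨rfl, rfl⟩ | ⟨rfl, rfl⟩
      · exact hbd.ne rfl
      · exact hnadj hbd
      · exact hnadj hbd.symm
    -- An alternating path needs two disjoint pairs of equally colored vertices, but `{a, y i}` is
    -- the only such pair.
    · intro b d e f hbd hde hef hbe hdf h₁ h₂
      have hde' := hde.ne
      have hbd' := hbd.ne
      rcases hc_eq _ _ h₁ with h | ⟨rfl, rfl⟩ | ⟨rfl, rfl⟩ <;>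
        rcases hc_eq _ _ h₂ with h' | ⟨h', h''⟩ | ⟨h', h''⟩ <;> simp_all
  refine le_starDegree_of_blocked_leaves hc i ?_ ?_ ?_
  · intro j k h
    rw [hcb _ (haw j).symm, hcb _ (haw k).symm] at h
    simpa using hinj h
  · intro j h
    rw [hcb _ (haw j).symm, hcb _ ha.ne] at h
    exact htw j (hinj h).symm
  · intro j c' h₁ h₂ h
    have hyw : (treeT n).Adj (y i) (w i j) := treeT_adj_y.2 (.inr (.inr (.inr ⟨j, rfl⟩)))
    refine h.ne_of_path ha.symm ht hyw hay (htw j) ?_ ?_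
    · rw [h₂ _ ha.ne.symm, h₂ _ ht.ne.symm, hca, hcb _ hay.symm]
    · rw [h₁, h₂ _ (htw j).symm]

theorem not_isLeaf_iff {t : TreeVertex n} :
    ¬ t.IsLeaf ↔ (∃ i, t = x₁ i) ∨ (∃ i, t = x₂ i) ∨ ∃ i, t = y i := by
  cases t <;> simp [IsLeaf]

theorem ncard_not_isLeaf (n : ℕ) : {t : TreeVertex n | ¬ t.IsLeaf}.ncard = 3 * n + 1 := by
  let f : Fin (n + 1) ⊕ Fin n ⊕ Fin n → TreeVertex n :=
    Sum.elim x₁ (Sum.elim x₂ y)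
  have hf : Function.Injective f := by
    rintro (i | i | i) (j | j | j) h <;> simp [f] at h <;> rw [h]
  have : {t : TreeVertex n | ¬ t.IsLeaf} = f '' Set.univ := by
    ext t
    simp [f, not_isLeaf_iff, eq_comm]
  rw [this, Set.ncard_image_of_injective _ hf, Set.ncard_univ]
  simp
  ring

theorem mStarDegree_treeT (hn : 2 ≤ n) : mStarDegree (treeT n) = 3 * n + 1 := by
  refine mStarDegree_eq (ncard_not_isLeaf n) ?_ ?_
  · intro t ht
    rcases not_isLeaf_iff.1 ht with ⟨i, rfl⟩ | ⟨i, rfl⟩ | ⟨i, rfl⟩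
    · cases i using Fin.cases with
      | zero =>
        have h : right (0 : Fin (n + 1)) = y ⟨0, by omega⟩ :=
          right_castSucc (⟨0, by omega⟩ : Fin n)
        have hr := treeT_adj_x₁.2 (.inr (rfl : right (0 : Fin (n + 1)) = _))
        rw [h] at hr
        exact le_starDegree_of_adj_y hr (treeT_adj_x₁.2 (.inl rfl)) (by simp)
      | succ i =>
        exact le_starDegree_of_adj_y (treeT_adj_x₁.2 (.inl rfl)) (treeT_adj_x₁.2 (.inr rfl))
          (left_ne_right i.succ).symm
    · exact le_starDegree_of_adj_y (treeT_adj_x₂.2 (.inl rfl)) (treeT_adj_x₂.2 (.inr rfl))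
        (by simp)
    · exact le_starDegree_y i
  · intro t ht
    have ht' : t.IsLeaf := not_not.1 ht
    -- `4 ≤ 3n` is where `2 ≤ n` is needed.
    exact ht'.starDegree_le.trans (by omega)

/-! ### Upper bound for `S_b` -/

/-- A color that occurs only on leaves and on vertices `x₁ i` with two differently colored neighbors
can be eliminated if there are at least eight colors. -/
theorem not_isMinimalElement_treeT (c : StarColoring (treeT n)) (h8 : 8 ≤ c.numColors) {i : ℕ}
    (hi : i ∈ Set.range c.1)
    (h : ∀ t, c.1 t = i → t.IsLeaf ∨ ∃ k, t = x₁ k ∧ c.1 (left k) ≠ c.1 (right k)) :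
    ¬ c.IsMinimalElement := by
  classical
  refine c.not_isMinimalElement_of_greedy hi fun t ht d hd hdc => ?_
  obtain ⟨l, hl, hB⟩ : ∃ l : List (TreeVertex n), l.length ≤ 6 ∧ t.IsBlockerList l := by
    rcases h t ht with hleaf | ⟨k, rfl, -⟩
    · obtain ⟨l, hl, hB⟩ := hleaf.exists_isBlockerList
      exact ⟨l, by omega, hB⟩
    · exact exists_isBlockerList_x₁ k
  have hnbr : ∀ a, (treeT n).Adj t a → d a = c.1 a := fun a ha =>
    hdc a fun hai => c.2.1 _ _ ha (ht.trans hai.symm)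
  -- At most six blocking colors and `i` itself are forbidden, so one of eight colors is free.
  obtain ⟨j, hj, hjl⟩ : ∃ j ∈ Set.range c.1, j ∉ (↑(insert i (l.map d).toFinset) : Set ℕ) := by
    refine Set.exists_mem_notMem_of_ncard_lt_ncard (lt_of_lt_of_le ?_ h8)
    rw [Set.ncard_coe_finset]
    have h₁ := Finset.card_insert_le i (l.map d).toFinset
    have h₂ := List.toFinset_card_le (l.map d)
    rw [List.length_map] at h₂
    omega
  rw [Finset.mem_coe, Finset.mem_insert, List.mem_toFinset, not_or] at hjl
  refine ⟨j, hj, hjl.1, hB.isStarColoring_update hd ?_ hjl.2⟩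
  intro a b ha hb hab
  rcases h t ht with hleaf | ⟨k, rfl, hk⟩
  · exact absurd (hleaf.eq_of_adj ha hb) hab
  · rw [hnbr a ha, hnbr b hb]
    rcases treeT_adj_x₁.1 ha with rfl | rfl <;> rcases treeT_adj_x₁.1 hb with rfl | rfl
    · exact absurd rfl hab
    · exact hk
    · exact hk.symm
    · exact absurd rfl hab

theorem numColors_le_of_isMinimalElement (hn : 3 ≤ n) {c : StarColoring (treeT n)}
    (hc : c.IsMinimalElement) : c.numColors ≤ 2 * n + 2 := by
  by_contra hlt
  -- Slot `j` records the color of `y j`, unless that repeats the color of the preceding `y`; the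
  -- slot is then free for the `x₁` between them. At `j = 0` there is no preceding `y`, and `x₁ 0`
  -- has a slot of its own in `F`.
  let g : Fin n → ℕ := fun j =>
    if c.1 (left j.castSucc) = c.1 (y j) ∧ (j : ℕ) ≠ 0 then c.1 (x₁ j.castSucc) else c.1 (y j)
  let F : Fin n ⊕ Fin n ⊕ Fin 2 → ℕ :=
    Sum.elim g (Sum.elim (fun j => c.1 (x₂ j)) ![c.1 (x₁ 0), c.1 (x₁ (Fin.last n))])
  -- The first `y` of a run of equally colored ones records their color.
  have hy : ∀ m (hm : m < n), c.1 (y ⟨m, hm⟩) ∈ Set.range g := by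
    intro m
    induction m with
    | zero =>
      intro hm
      exact ⟨⟨0, hm⟩, if_neg (by simp)⟩
    | succ m ih =>
      intro hm
      by_cases h : c.1 (left (⟨m + 1, hm⟩ : Fin n).castSucc) = c.1 (y ⟨m + 1, hm⟩)
      · rw [← h]
        exact ih (by omega)
      · exact ⟨⟨m + 1, hm⟩, if_neg fun h' => h h'.1⟩
  have hF : Set.range c.1 ⊆ Set.range F := by
    intro i hi
    by_contra hiF
    have hig : i ∉ Set.range g := fun ⟨j, hj⟩ => hiF ⟨.inl j, hj⟩
    -- More than `2n + 2` colors are at least eight because `3 ≤ n`.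
    refine not_isMinimalElement_treeT c (by omega) hi (fun t ht => ?_) hc
    by_contra! hcon
    obtain ⟨hleaf, hx⟩ := hcon
    rcases not_isLeaf_iff.1 hleaf with ⟨k, rfl⟩ | ⟨k, rfl⟩ | ⟨k, rfl⟩
    · have hk := hx k rfl
      cases k using Fin.lastCases with
      | last => exact hiF ⟨.inr (.inr 1), ht⟩
      | cast k =>
        rw [right_castSucc] at hk
        by_cases hk0 : (k : ℕ) = 0
        · refine hiF ⟨.inr (.inr 0), ?_⟩
          rw [show k.castSucc = 0 from Fin.ext hk0] at ht
          exact ht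
        · exact hig ⟨k, (if_pos ⟨hk, hk0⟩).trans ht⟩
    · exact hiF ⟨.inr (.inl k), ht⟩
    · exact hig (ht ▸ hy k k.2)
  have h₁ := Set.ncard_le_ncard hF (Set.finite_range F)
  have h₂ : (Set.range F).ncard ≤ n + (n + 2) := by
    rw [← Set.image_univ]
    refine (Set.ncard_image_le Set.finite_univ).trans ?_
    rw [Set.ncard_univ]
    simp
  have h₃ : c.numColors = (Set.range c.1).ncard := rfl
  omega

/-! ### Lower bound for `S_b` -/

/-- A star coloring with `2 * n + 2` colors: one color for `u`, `v` and all `y i` and `z i`, and a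
color of its own for each `x₁ i` and `x₂ i`. The leaves at `y i` complete the set of colors. -/
def TreeVertex.extremalColor : TreeVertex n → ℕ
  | u => 0
  | v => 0
  | y _ => 0
  | z _ => 0
  | x₁ i => i + 1
  | x₂ i => n + 2 + i
  | w i j =>
    if (j : ℕ) < 2 * n + 1 ∧ (j : ℕ) ≠ i ∧ (j : ℕ) ≠ i + 1 ∧ (j : ℕ) ≠ n + 1 + i then j + 1
    else if (i : ℕ) = 0 then 3 else 1

@[simp] theorem TreeVertex.extremalColor_left (i : Fin (n + 1)) : (left i).extremalColor = 0 := by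
  cases i using Fin.cases <;> rfl

@[simp] theorem TreeVertex.extremalColor_right (i : Fin (n + 1)) : (right i).extremalColor = 0 := by
  cases i using Fin.lastCases with
  | last => rw [right_last]; rfl
  | cast i => rw [right_castSucc]; rfl

theorem TreeVertex.extremalColor_le (hn : 2 ≤ n) (t : TreeVertex n) :
    t.extremalColor ≤ 2 * n + 1 := by
  cases t <;> simp only [extremalColor] <;> grind

/-- The excluded values are the colors of `y i` and its three inner neighbors. The fallback color is
3 for `i = 0`, where 1, 2 and `n + 2` are taken, and 1 otherwise. -/
theorem TreeVertex.extremalColor_w (hn : 2 ≤ n) (i : Fin n) (j : Fin (3 * n)) :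
    (w i j).extremalColor ≠ 0 ∧ (w i j).extremalColor ≠ i + 1 ∧ (w i j).extremalColor ≠ i + 2 ∧
      (w i j).extremalColor ≠ n + 2 + i := by
  simp only [extremalColor]
  grind

theorem TreeVertex.exists_adj_y_extremalColor (i : Fin n) {k : ℕ} (hk0 : k ≠ 0)
    (hk : k ≤ 2 * n + 1) : ∃ t, (treeT n).Adj (y i) t ∧ t.extremalColor = k := by
  simp only [treeT_adj_y]
  by_cases h₁ : k = i + 1
  · exact ⟨_, .inl rfl, by simp [extremalColor, h₁]⟩
  by_cases h₂ : k = i + 2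
  · exact ⟨_, .inr (.inl rfl), by simp [extremalColor, h₂]⟩
  by_cases h₃ : k = n + 2 + i
  · exact ⟨_, .inr (.inr (.inl rfl)), by simp [extremalColor, h₃]⟩
  -- The leaf index exists since `k - 1 ≤ 2n < 3n`.
  refine ⟨_, .inr (.inr (.inr ⟨⟨k - 1, by have := i.2; omega⟩, rfl⟩)), ?_⟩
  simp only [extremalColor]
  rw [if_pos (by omega)]
  omega

/-- Color `0` fills exactly one side of the bipartition, so one of the two middle vertices of any
four-vertex path has color `0`. -/
theorem TreeVertex.extremalColor_eq_zero_iff_of_adj (hn : 2 ≤ n) {a b : TreeVertex n}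
    (h : (treeT n).Adj a b) : a.extremalColor = 0 ↔ b.extremalColor ≠ 0 := by
  have hw := extremalColor_w hn
  rw [treeT_adj] at h
  rcases h with h | h <;> cases h <;> simp [extremalColor.eq_1, extremalColor.eq_2,
    extremalColor.eq_3, extremalColor.eq_4, extremalColor.eq_5, extremalColor.eq_6, (hw _ _).1]

/-- Since `d` has a second neighbor, it is not a leaf, and the color of an inner neighbor of `y i`
occurs only once around `y i`. -/
theorem TreeVertex.eq_of_extremalColor_eq (hn : 2 ≤ n) {a b d e : TreeVertex n}
    (hab : (treeT n).Adj a b) (hbd : (treeT n).Adj b d) (hde : (treeT n).Adj d e)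
    (hbe : b ≠ e) (hb : b.extremalColor = 0) (h : a.extremalColor = d.extremalColor) : a = d := by
  have hw := extremalColor_w hn
  cases b with
  | u => exact (treeT_adj_u.1 hab.symm).trans (treeT_adj_u.1 hbd).symm
  | v => exact (treeT_adj_v.1 hab.symm).trans (treeT_adj_v.1 hbd).symm
  | z i => exact (treeT_adj_z.1 hab.symm).trans (treeT_adj_z.1 hbd).symm
  | x₁ i => simp [extremalColor] at hb
  | x₂ i => simp [extremalColor] at hb
  | w i j => exact absurd hb (hw i j).1
  | y i =>
    have hi := i.2
    rcases eq_of_adj_y_of_adj hbd hde hbe.symm with rfl | rfl | rfl <;>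
      rcases treeT_adj_y.1 hab.symm with rfl | rfl | rfl | ⟨j, rfl⟩ <;>
      first
      | rfl
      | (exfalso; have := hw i j; simp [extremalColor.eq_5, extremalColor.eq_6] at h; omega)
      | (exfalso; simp [extremalColor.eq_5, extremalColor.eq_6] at h <;> omega)

theorem isStarColoring_extremalColor (hn : 2 ≤ n) :
    IsStarColoring (treeT n) extremalColor := by
  have hadj := fun a b h => extremalColor_eq_zero_iff_of_adj hn (a := a) (b := b) h
  refine .of_acyclic (treeT_isAcyclic n) ?_ ?_
  · intro a b h heq
    have := hadj a b h
    rw [heq] at this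
    tauto
  · intro a b d e hab hbd hde had hbe h₁ h₂
    by_cases hb : b.extremalColor = 0
    · exact had (eq_of_extremalColor_eq hn hab hbd hde hbe hb h₁)
    · have hd : d.extremalColor = 0 := by
        have := hadj b d hbd
        tauto
      exact hbe (eq_of_extremalColor_eq hn hde.symm hbd.symm hab.symm had.symm hd h₂.symm).symm

theorem range_extremalColor (hn : 2 ≤ n) :
    Set.range (extremalColor : TreeVertex n → ℕ) = Set.Iic (2 * n + 1) := by
  ext k
  constructor
  · rintro ⟨t, rfl⟩
    exact extremalColor_le hn t
  · intro hk
    by_cases hk0 : k = 0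
    · exact ⟨u, hk0.symm⟩
    · obtain ⟨t, -, ht⟩ := exists_adj_y_extremalColor (n := n) ⟨0, by omega⟩ hk0 hk
      exact ⟨t, ht⟩

/-- If `t` lies between `y i` and another vertex of the same color and every color other than that
of `y i` occurs at `y i`, then the color of `t` cannot be eliminated. -/
theorem not_starRecoloringStep_of_adj {c c' : StarColoring (treeT n)} {i : Fin n}
    {t a : TreeVertex n} (ht : (treeT n).Adj t (y i)) (ha : (treeT n).Adj t a) (hay : a ≠ y i)
    (hcol : c.1 a = c.1 (y i))
    (hall : ∀ k ∈ Set.range c.1, k ≠ c.1 (y i) → ∃ s, (treeT n).Adj (y i) s ∧ c.1 s = k)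
    (h₁ : ∀ s, c.1 s ≠ c.1 t → c'.1 s = c.1 s)
    (h₂ : ∀ s, c.1 s = c.1 t → c'.1 s ∈ Set.range c.1 ∧ c'.1 s ≠ c.1 t ∧
      ∀ s', (treeT n).Adj s s' → c'.1 s ≠ c.1 s') : False := by
  obtain ⟨hr, hne, hnbr⟩ := h₂ t rfl
  -- The new color of `t` already occurs at a neighbor `s` of `y i`, so `a, t, y i, s` becomes
  -- alternating.
  obtain ⟨s, hs, hsk⟩ := hall _ hr (hnbr _ ht)
  have hst : c.1 s ≠ c.1 t := hsk ▸ hne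
  have hyt : c.1 (y i) ≠ c.1 t := (c.2.1 _ _ ht).symm
  refine c'.2.ne_of_path ha.symm ht hs hay ?_ ?_ ?_
  · rintro rfl
    exact hst rfl
  · rw [h₁ _ hyt, h₁ a (hcol ▸ hyt), hcol]
  · rw [h₁ _ hst, hsk]

/-- The coloring `TreeVertex.extremalColor` as a star coloring. -/
def extremalStarColoring (hn : 2 ≤ n) : StarColoring (treeT n) :=
  ⟨extremalColor, isStarColoring_extremalColor hn⟩

theorem isMinimalElement_extremalStarColoring (hn : 2 ≤ n) :
    (extremalStarColoring hn).IsMinimalElement := by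
  rw [StarColoring.isMinimalElement_iff]
  rintro c' ⟨k, hk, h₁, h₂⟩
  have hall : ∀ i : Fin n, ∀ k ∈ Set.range (extremalColor : TreeVertex n → ℕ),
      k ≠ (y i).extremalColor → ∃ s, (treeT n).Adj (y i) s ∧ s.extremalColor = k := by
    intro i k hk hk0
    rw [range_extremalColor hn] at hk
    exact exists_adj_y_extremalColor i hk0 hk
  have hk' : k ≤ 2 * n + 1 := by
    obtain ⟨t, rfl⟩ := hk
    exact extremalColor_le hn t
  -- A vertex `y` sees every nonzero color, so color `0` cannot be eliminated.
  rcases Nat.eq_zero_or_pos k with rfl | hpos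
  · obtain ⟨hr, hne, hnbr⟩ := h₂ (y ⟨0, by omega⟩) rfl
    obtain ⟨s, hs, hsk⟩ := hall _ _ hr hne
    exact hnbr s hs hsk.symm
  by_cases hkn : k ≤ n + 1
  · obtain ⟨i, rfl⟩ : ∃ i : Fin (n + 1), (x₁ i).extremalColor = k :=
      ⟨⟨k - 1, by omega⟩, by simp only [extremalColor]; omega⟩
    cases i using Fin.lastCases with
    | last =>
      obtain ⟨m, rfl⟩ : ∃ m, n = m + 1 := ⟨n - 1, by omega⟩
      refine not_starRecoloringStep_of_adj (t := x₁ (Fin.last (m + 1))) (i := Fin.last m)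
        (treeT_adj_x₁.2 (.inl (left_succ (Fin.last m)).symm)) (treeT_adj_x₁.2 (.inr rfl))
        (by simp) (extremalColor_right _) (hall _) h₁ h₂
    | cast i =>
      refine not_starRecoloringStep_of_adj (t := x₁ i.castSucc) (i := i)
        (treeT_adj_x₁.2 (.inr (right_castSucc i).symm)) (treeT_adj_x₁.2 (.inl rfl))
        ?_ (extremalColor_left _) (hall _) h₁ h₂
      have := left_ne_right i.castSucc
      rwa [right_castSucc] at this
  · obtain ⟨i, rfl⟩ : ∃ i : Fin n, (x₂ i).extremalColor = k :=
      ⟨⟨k - (n + 2), by omega⟩, by simp only [extremalColor]; omega⟩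
    exact not_starRecoloringStep_of_adj (t := x₂ i) (i := i) (treeT_adj_x₂.2 (.inl rfl))
      (treeT_adj_x₂.2 (.inr rfl)) (by simp) rfl (hall _) h₁ h₂

theorem starBChromaticNumber_treeT (hn : 3 ≤ n) : starBChromaticNumber (treeT n) = 2 * n + 2 := by
  refine IsGreatest.csSup_eq ⟨⟨_, isMinimalElement_extremalStarColoring (by omega), ?_⟩, ?_⟩
  · change (Set.range extremalColor).ncard = 2 * n + 2
    rw [range_extremalColor (by omega), ← Nat.card_coe_set_eq]
    simp
  · rintro _ ⟨c, hc, rfl⟩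
    exact numColors_le_of_isMinimalElement hn hc

end Tree

theorem theorem6p3 :
    (∀ n : ℕ, 1 ≤ n → (treeT n).IsTree) ∧
    (∀ n : ℕ, 2 ≤ n → mStarDegree (treeT n) = 3 * n + 1) ∧
    (∀ n : ℕ, 3 ≤ n → starBChromaticNumber (treeT n) = 2 * n + 2) ∧
    Filter.Tendsto
      (fun n : ℕ => (mStarDegree (treeT n) : ℤ) - (starBChromaticNumber (treeT n) : ℤ))
      Filter.atTop Filter.atTop := by
  refine ⟨fun n _ => treeT_isTree n, fun n => mStarDegree_treeT,
    fun n => starBChromaticNumber_treeT, ?_⟩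
  rw [Filter.tendsto_atTop]
  intro b
  -- The bound gives both `3 ≤ n` and `b ≤ n - 1`.
  filter_upwards [Filter.eventually_ge_atTop (b.toNat + 3)] with n hn
  rw [mStarDegree_treeT (by omega), starBChromaticNumber_treeT (by omega)]
  push_cast
  omega
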